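/- All functions and controls are complex-valued. Let $H^0=L^2(\mathbb R^2)$, $H^{-2}=H^{-2}(\mathbb R^2)$, and let $\widehat H^0$ and $\widehat H^{-2}$ be their subspaces of distributions that are even with respect to $x_1$. For $T>0$, $u\in L^\infty(0,T)$ and $W^0\in\widehat H^0$ consider the control system $$W_t=\Delta W-2\,u(t)\,\delta,\quad t\in(0,T),\qquad W(\cdot,0)=W^0,$$ where $\delta$ is the Dirac distribution at $0\in\mathbb R^2$. A solution is a function $W:[0,T]\to\widehat H^0$ with $W(\cdot,0)=W^0$ that is absolutely continuous as a function with values in $H^{-2}$ and whose derivative $W_t(t)\in\widehat H^{-2}$ satisfies the equation for almost all $t\in(0,T)$. Let $\mathcal R_T(W^0)$ be the set of all $W^T\in\widehat H^0$ for which there is a control $u\in L^\infty(0,T)$ such that the system has a unique solution $W$ and this solution satisfies $W(\cdot,T)=W^T$. Let $$\mathcal H=\{f\in L^2(\mathbb R^2)\;:\;\exists\, g\in L^2(0,\infty)\ \text{ such that } f(x)=g(|x|^2)\ \text{ for almost all } x\in\mathbb R^2\}.$$ **Theorem.** For every $T>0$, the closure of $\mathcal R_T(0)$ in $L^2(\mathbb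 R^2)$ is equal to $\mathcal H$. -/

import Mathlib

open MeasureTheory Set
open scoped SchwartzMap Laplacian ENNReal

noncomputable section

namespace HeatPointControl

/-- The Euclidean plane `ℝ²`. The coordinates `x₁`, `x₂` are `x 0`, `x 1`. -/
abbrev Plane : Type := EuclideanSpace ℝ (Fin 2)

/-- The complex Hilbert space `L²(ℝ²) = H⁰(ℝ²)`. -/
abbrev L2Plane : Type := Lp ℂ 2 (volume : Measure Plane)

/-- A tempered distribution `f` on `ℝ²` is even with respect to `x₁` if
`⟨f, φ⟩ = ⟨f, φ(-x₁, x₂)⟩` for all Schwartz functions `φ`; here `ψ` is the reflected `φ`. -/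
def IsEvenInFirst (f : 𝓢'(Plane, ℂ)) : Prop :=
  ∀ φ ψ : 𝓢(Plane, ℂ), (∀ x : Plane, ψ x = φ !₂[-x 0, x 1]) → f φ = f ψ

/-- The space of those `f ∈ L²(ℝ²)` that are even with respect to `x₁`. -/
def evenL2 : Set L2Plane :=
  {f | IsEvenInFirst (f : 𝓢'(Plane, ℂ))}

/-- `W'` is the time derivative of `W` on `(0, T)`, both being regarded as functions of time with
values in `H⁻²(ℝ²)`: `W'` is an integrable function of time with values in `H⁻²(ℝ²)`, and
`W(t) = W(0) + ∫₀ᵗ W'(s) ds` in `H⁻²(ℝ²)` for all `t ∈ [0, T]`. (Equivalently, `W` is absolutely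
continuous from `[0, T]` to `H⁻²(ℝ²)` with derivative `W'(t)` at almost every `t`.)

The space `H⁻²(ℝ²)` consists of the tempered distributions `f` whose Bessel potential of order `-2`
belongs to `L²(ℝ²)`, and its norm is, up to equivalence, the `L²`-norm of that Bessel potential.
So the Bochner integral in `H⁻²(ℝ²)` is taken in `L²(ℝ²)` after applying the Bessel potential, and
`Z t` is the image of `W' t`. -/
def HasTimeDerivHNegTwo (T : ℝ) (W W' : ℝ → 𝓢'(Plane, ℂ)) : Prop :=
  ∃ Z : ℝ → L2Plane,
    IntervalIntegrable Z volume 0 T ∧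
    (∀ᵐ t ∂(volume.restrict (Ioo 0 T)),
      TemperedDistribution.besselPotential Plane ℂ (-2) (W' t) = (Z t : 𝓢'(Plane, ℂ))) ∧
    ∀ t ∈ Icc 0 T,
      TemperedDistribution.besselPotential Plane ℂ (-2) (W t) =
        TemperedDistribution.besselPotential Plane ℂ (-2) (W 0) +
          ((∫ s in (0 : ℝ)..t, Z s : L2Plane) : 𝓢'(Plane, ℂ))

/-- `W` is a solution on `[0, T]` of the control system
`W_t = Δ W - 2 δ u(t)`, `t ∈ (0, T)`, with `W(·, 0) = W₀`,
where `W` takes values in the even functions of `L²(ℝ²)` and `W_t` takes values in `H⁻²(ℝ²)`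
(it is then even as well, as `Δ` preserves evenness and `δ` is even).
Only the values of `W` on `[0, T]` matter. -/
structure IsSolution (T : ℝ) (u : ℝ → ℂ) (W₀ : L2Plane) (W : ℝ → L2Plane) : Prop where
  mem_even : ∀ t ∈ Icc 0 T, W t ∈ evenL2
  initial : W 0 = W₀
  equation : HasTimeDerivHNegTwo T
    (fun t => (W t : 𝓢'(Plane, ℂ)))
    (fun t => Δ (W t : 𝓢'(Plane, ℂ)) - (2 * u t) • TemperedDistribution.delta (0 : Plane))

/-- The set of the states reachable from `W₀` in time `T`: all even `WT ∈ L²(ℝ²)` for which there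
is a control `u ∈ L^∞(0, T)` such that the control system has a unique solution `W` on `[0, T]`
and `W(·, T) = WT`. -/
def reachableSet (T : ℝ) (W₀ : L2Plane) : Set L2Plane :=
  {WT | WT ∈ evenL2 ∧ ∃ u : ℝ → ℂ, MemLp u ∞ (volume.restrict (Ioo 0 T)) ∧
    ∃ W : ℝ → L2Plane, IsSolution T u W₀ W ∧
      (∀ V : ℝ → L2Plane, IsSolution T u W₀ V → EqOn V W (Icc 0 T)) ∧
      W T = WT}

/-- The space of all `f ∈ L²(ℝ²)` such that, for some `g ∈ L²(ℝ₊)`, `f(x) = g(|x|²)` for almost all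
`x ∈ ℝ²`. -/
def radialL2 : Set L2Plane :=
  {f | ∃ g : Lp ℂ 2 (volume.restrict (Ioi (0 : ℝ))), ∀ᵐ x : Plane, f x = g (‖x‖ ^ 2)}

end HeatPointControl

end

/-! The solution from rest is given by Duhamel's formula `W(t) = -2 ∫₀ᵗ u(s) K(t - s) ds`, where `K`
is the heat kernel. The integral converges in `L²` because `‖K(t)‖² = 1/(8πt)`, so `‖K(t)‖` has only
an integrable singularity at `0`. The Bessel potential of order `-2` turns the equation in `H⁻²`
into an integral equation in `L²` (`isSolution_iff`). There Duhamel's formula is verified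
(`isSolution_controlledState`), and uniqueness follows by cutting off high frequencies, where `Δ`
becomes bounded and Grönwall applies (`IsSolution.eqOn`). Hence the reachable set is the linear
space of these integrals; every `K(t)` is radial and the radial functions are closed, which gives
one inclusion.

For density, let a radial `f = g(|x|²)` be orthogonal to all reachable states. Varying `u` gives
`⟨K(t), f⟩ = 0` for all `t ∈ (0, T)` (`inner_heatKernel_eq_zero`). The substitution `r = |x|²` turns
this into the vanishing of the Laplace transform of `g` at every `p = 1/(4t) > 1/(4T)`. Values along
one arithmetic progression already force `g = 0` (`ae_eq_zero_of_laplace_eq_zero`), so arbitrarily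
small `T` suffices. -/

noncomputable section

namespace HeatPointControl

open FourierTransform TemperedDistribution Filter Topology

/-! ### Fourier multipliers on `L²`. -/

/-- Multiplication by an essentially bounded function, as an operator on `L²(ℝ²)`. -/
def mulOp (g : Plane → ℂ) (hg : MemLp g ∞ (volume : Measure Plane)) : L2Plane →L[ℂ] L2Plane :=
  (ContinuousLinearMap.lsmul ℂ ℂ).holderL volume ∞ 2 2 (hg.toLp g)

theorem mulOp_apply {g : Plane → ℂ} (hg : MemLp g ∞ (volume : Measure Plane)) (f : L2Plane) :
    mulOp g hg f = (hg.toLp g : Lp ℂ ∞ (volume : Measure Plane)) • f := rfl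

theorem coeFn_mulOp {g : Plane → ℂ} (hg : MemLp g ∞ (volume : Measure Plane)) (f : L2Plane) :
    mulOp g hg f =ᵐ[volume] fun x => g x * f x := by
  rw [mulOp_apply]
  filter_upwards [Lp.coeFn_lpSMul (r := 2) (hg.toLp g) f, hg.coeFn_toLp] with x h1 h2
  simp [h1, h2]

theorem mulOp_toTemperedDistribution {g : Plane → ℂ} (hg : MemLp g ∞ (volume : Measure Plane))
    (hg' : g.HasTemperateGrowth) (f : L2Plane) :
    ((mulOp g hg f : L2Plane) : 𝓢'(Plane, ℂ)) = smulLeftCLM ℂ g (f : 𝓢'(Plane, ℂ)) :=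
  Lp.toTemperedDistribution_smul_eq hg' hg f

theorem toTemperedDistribution_injective :
    Function.Injective (fun f : L2Plane => (f : 𝓢'(Plane, ℂ))) := by
  have h := Lp.ker_toTemperedDistributionCLM_eq_bot (F := ℂ) (μ := (volume : Measure Plane)) (p := 2)
  exact LinearMap.ker_eq_bot.1 h

/-- The Fourier multiplier on `L²(ℝ²)` with an essentially bounded symbol. -/
def fourierMul (g : Plane → ℂ) (hg : MemLp g ∞ (volume : Measure Plane)) : L2Plane →L[ℂ] L2Plane :=
  (fourierInvCLM ℂ L2Plane) ∘L mulOp g hg ∘L (fourierCLM ℂ L2Plane)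

theorem fourier_fourierMul {g : Plane → ℂ} (hg : MemLp g ∞ (volume : Measure Plane))
    (f : L2Plane) : 𝓕 (fourierMul g hg f) = mulOp g hg (𝓕 f) := by
  simp [fourierMul]

theorem fourierMul_toTemperedDistribution {g : Plane → ℂ}
    (hg : MemLp g ∞ (volume : Measure Plane))
    (hg' : g.HasTemperateGrowth) (f : L2Plane) :
    ((fourierMul g hg f : L2Plane) : 𝓢'(Plane, ℂ)) =
      fourierMultiplierCLM ℂ g (f : 𝓢'(Plane, ℂ)) := by
  rw [fourierMultiplierCLM_apply, Lp.fourier_toTemperedDistribution_eq,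
    ← mulOp_toTemperedDistribution hg hg', Lp.fourierInv_toTemperedDistribution_eq]
  rfl

/-! ### The equation in `H⁻²`, rewritten in `L²`. -/

/-- The symbol `(1 + |ξ|²)⁻¹` of the Bessel potential of order `-2`. -/
def besselSymbol (x : Plane) : ℂ := ((1 + ‖x‖ ^ 2) ^ ((-2 : ℝ) / 2) : ℝ)

/-- The symbol `4π²|ξ|²` of `-Δ`. -/
def heatSymbol (x : Plane) : ℝ := (2 * Real.pi) ^ 2 * ‖x‖ ^ 2

theorem heatSymbol_nonneg (x : Plane) : 0 ≤ heatSymbol x := by unfold heatSymbol; positivity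

theorem continuous_heatSymbol : Continuous heatSymbol := by unfold heatSymbol; fun_prop

theorem besselSymbol_eq (x : Plane) : besselSymbol x = ((1 + ‖x‖ ^ 2)⁻¹ : ℝ) := by
  unfold besselSymbol
  norm_num [Real.rpow_neg_one]

theorem besselSymbol_ne_zero (x : Plane) : besselSymbol x ≠ 0 := by
  rw [besselSymbol_eq]
  have : (1 + ‖x‖ ^ 2)⁻¹ ≠ 0 := by positivity
  exact_mod_cast this

theorem hasTemperateGrowth_besselSymbol : besselSymbol.HasTemperateGrowth := by
  unfold besselSymbol; fun_prop

theorem continuous_besselSymbol : Continuous besselSymbol :=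
  hasTemperateGrowth_besselSymbol.1.continuous

theorem memLp_top_besselSymbol : MemLp besselSymbol ∞ (volume : Measure Plane) := by
  refine memLp_top_of_bound continuous_besselSymbol.aestronglyMeasurable 1 (.of_forall fun x => ?_)
  rw [besselSymbol_eq, Complex.norm_real, Real.norm_of_nonneg (by positivity)]
  exact inv_le_one_of_one_le₀ (by nlinarith [sq_nonneg ‖x‖])

/-- The symbol of the Bessel potential of order `-2` of the Laplacian. -/
def laplaceSymbol (x : Plane) : ℂ := -(heatSymbol x : ℂ) * besselSymbol x

theorem hasTemperateGrowth_heatSymbol : (fun x => (heatSymbol x : ℂ)).HasTemperateGrowth := by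
  unfold heatSymbol; fun_prop

theorem hasTemperateGrowth_laplaceSymbol : laplaceSymbol.HasTemperateGrowth :=
  hasTemperateGrowth_heatSymbol.neg.mul hasTemperateGrowth_besselSymbol

/-- Since `|ξ|² / (1 + |ξ|²) ≤ 1`, the Laplacian is bounded from `L²` to `H⁻²`. -/
theorem memLp_top_laplaceSymbol : MemLp laplaceSymbol ∞ (volume : Measure Plane) := by
  refine memLp_top_of_bound hasTemperateGrowth_laplaceSymbol.1.continuous.aestronglyMeasurable
    ((2 * Real.pi) ^ 2) (.of_forall fun x => ?_)
  rw [laplaceSymbol, besselSymbol_eq, norm_mul, norm_neg, Complex.norm_real, Complex.norm_real,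
    Real.norm_of_nonneg (heatSymbol_nonneg x), Real.norm_of_nonneg (by positivity), heatSymbol,
    mul_assoc]
  refine mul_le_of_le_one_right (by positivity) ?_
  rw [← div_eq_mul_inv, div_le_one (by positivity)]
  linarith

/-- The square decays like `|ξ|⁻⁴`, and `4` exceeds the dimension `2`. This is what places `δ` in
`H⁻²`. -/
theorem memLp_two_besselSymbol : MemLp besselSymbol 2 (volume : Measure Plane) := by
  rw [memLp_two_iff_integrable_sq_norm continuous_besselSymbol.aestronglyMeasurable]
  have h := integrable_rpow_neg_one_add_norm_sq (E := Plane) (μ := volume) (r := 4) (by simp; norm_num)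
  refine h.congr (.of_forall fun x => ?_)
  have hx : 0 < 1 + ‖x‖ ^ 2 := by positivity
  simp only [besselSymbol_eq, Complex.norm_real]
  rw [Real.norm_of_nonneg (by positivity), inv_pow, show (-4 : ℝ) / 2 = -(2 : ℕ) by norm_num,
    Real.rpow_neg hx.le, Real.rpow_natCast]

/-- The Bessel potential of order `-2` on `L²(ℝ²)`. -/
def besselOp : L2Plane →L[ℂ] L2Plane := fourierMul besselSymbol memLp_top_besselSymbol

/-- The Bessel potential of order `-2` of the Laplacian on `L²(ℝ²)`. -/
def laplaceOp : L2Plane →L[ℂ] L2Plane := fourierMul laplaceSymbol memLp_top_laplaceSymbol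

/-- The Bessel potential of order `-2` of the Dirac distribution. -/
def besselDelta : L2Plane := 𝓕⁻ (memLp_two_besselSymbol.toLp besselSymbol : L2Plane)

theorem besselPotential_coe (f : L2Plane) :
    besselPotential Plane ℂ (-2) (f : 𝓢'(Plane, ℂ)) = (besselOp f : L2Plane) := by
  rw [besselOp, fourierMul_toTemperedDistribution _ hasTemperateGrowth_besselSymbol]
  rfl

theorem besselPotential_laplacian_coe (f : L2Plane) :
    besselPotential Plane ℂ (-2) (Δ (f : 𝓢'(Plane, ℂ))) = (laplaceOp f : L2Plane) := by
  change fourierMultiplierCLM ℂ besselSymbol _ = _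
  rw [laplaceOp, fourierMul_toTemperedDistribution _ hasTemperateGrowth_laplaceSymbol,
    laplacian_eq_fourierMultiplierCLM, ContinuousLinearMap.map_smul_of_tower,
    fourierMultiplierCLM_fourierMultiplierCLM_apply (by fun_prop) hasTemperateGrowth_besselSymbol]
  have : laplaceSymbol = ((-(2 * Real.pi) ^ 2 : ℝ) : ℂ) •
      ((fun x : Plane => Complex.ofReal (‖x‖ ^ 2)) * besselSymbol) := by
    ext x
    simp [laplaceSymbol, heatSymbol]
    ring
  rw [this, fourierMultiplierCLM_smul (.mul (by fun_prop) hasTemperateGrowth_besselSymbol)]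
  rw [Complex.coe_smul]
  rfl

theorem besselPotential_delta :
    besselPotential Plane ℂ (-2) (delta (0 : Plane)) = (besselDelta : 𝓢'(Plane, ℂ)) := by
  rw [besselDelta, ← Lp.fourierInv_toTemperedDistribution_eq, besselPotential,
    fourierMultiplierCLM_apply, fourier_delta_zero]
  congr 1
  ext φ
  simp only [smulLeftCLM_apply_apply, Measure.toTemperedDistribution_apply,
    Lp.toTemperedDistribution_apply]
  refine integral_congr_ae ?_
  filter_upwards [memLp_two_besselSymbol.coeFn_toLp] with x hx
  rw [hx]
  have := SchwartzMap.smulLeftCLM_apply_apply (F := ℂ) hasTemperateGrowth_besselSymbol φ x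
  rw [smul_eq_mul, mul_comm]
  exact this

/-- All terms, after the Bessel potential, lie in `L²`, which embeds injectively into the tempered
distributions; so the identities can be read in `L²` with the bounded operators `besselOp` and
`laplaceOp`. -/
theorem isSolution_iff {T : ℝ} {u : ℝ → ℂ} {W₀ : L2Plane} {W : ℝ → L2Plane} :
    IsSolution T u W₀ W ↔ (∀ t ∈ Icc 0 T, W t ∈ evenL2) ∧ W 0 = W₀ ∧
      ∃ Z : ℝ → L2Plane, IntervalIntegrable Z volume 0 T ∧
        (∀ᵐ t ∂(volume.restrict (Ioo 0 T)), Z t = laplaceOp (W t) - (2 * u t) • besselDelta) ∧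
        ∀ t ∈ Icc 0 T, besselOp (W t) = besselOp (W 0) + ∫ s in (0 : ℝ)..t, Z s := by
  have key : ∀ t, besselPotential Plane ℂ (-2)
      (Δ (W t : 𝓢'(Plane, ℂ)) - (2 * u t) • delta (0 : Plane)) =
      ((laplaceOp (W t) - (2 * u t) • besselDelta : L2Plane) : 𝓢'(Plane, ℂ)) := by
    intro t
    rw [map_sub, map_smul, besselPotential_laplacian_coe, besselPotential_delta]
    simp only [← Lp.toTemperedDistributionCLM_apply, map_sub, map_smul]
  have key2 : ∀ (t : ℝ) (I : L2Plane), besselPotential Plane ℂ (-2) (W t : 𝓢'(Plane, ℂ)) =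
      besselPotential Plane ℂ (-2) (W 0 : 𝓢'(Plane, ℂ)) + (I : 𝓢'(Plane, ℂ)) ↔
      besselOp (W t) = besselOp (W 0) + I := by
    intro t I
    rw [besselPotential_coe, besselPotential_coe, ← toTemperedDistribution_injective.eq_iff]
    simp only [← Lp.toTemperedDistributionCLM_apply, map_add]
  constructor
  · rintro ⟨h1, h2, Z, hZ, h3, h4⟩
    refine ⟨h1, h2, Z, hZ, ?_, fun t ht => (key2 t _).1 (h4 t ht)⟩
    filter_upwards [h3] with t ht
    exact toTemperedDistribution_injective (ht.symm.trans (key t))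
  · rintro ⟨h1, h2, Z, hZ, h3, h4⟩
    refine ⟨h1, h2, Z, hZ, ?_, fun t ht => (key2 t _).2 (h4 t ht)⟩
    filter_upwards [h3] with t ht
    rw [ht]
    exact key t

/-! ### Grönwall uniqueness and Duhamel's formula in a Banach space. -/

section Abstract

variable {X : Type*} [NormedAddCommGroup X] [NormedSpace ℂ X]

theorem eq_zero_of_eq_integral [CompleteSpace X] (A : X →L[ℂ] X) {T : ℝ} {w : ℝ → X}
    (hw : ContinuousOn w (Icc 0 T))
    (h : ∀ t ∈ Icc 0 T, w t = ∫ s in (0 : ℝ)..t, A (w s)) : ∀ t ∈ Icc 0 T, w t = 0 := by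
  intro t₀ ht₀
  have hT : 0 ≤ T := ht₀.1.trans ht₀.2
  -- Extending `w` by its endpoint values makes the primitive `y` differentiable on all of `ℝ`;
  -- Grönwall's inequality then applies to `y`, which agrees with `w` on `[0, T]`.
  set c : ℝ → X := IccExtend hT ((Icc (0 : ℝ) T).domRestrict w) with hc
  have hcc : Continuous c := (continuousOn_iff_continuous_domRestrict.1 hw).Icc_extend'
  have hcw : ∀ t ∈ Icc 0 T, c t = w t := fun t ht => by
    rw [hc, IccExtend_of_mem _ _ ht]; rfl
  have hAc : Continuous fun s => A (c s) := A.continuous.comp hcc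
  set y : ℝ → X := fun t => ∫ s in (0 : ℝ)..t, A (c s) with hy
  have hyd : ∀ t, HasDerivAt y (A (c t)) t := fun t =>
    (hAc.integral_hasStrictDerivAt 0 t).hasDerivAt
  have hyw : ∀ t ∈ Icc 0 T, y t = w t := by
    intro t ht
    rw [h t ht]
    refine intervalIntegral.integral_congr fun s hs => ?_
    rw [uIcc_of_le ht.1] at hs
    simp only [hcw s ⟨hs.1, hs.2.trans ht.2⟩]
  rw [← hyw t₀ ht₀]
  refine eq_zero_of_abs_deriv_le_mul_abs_self_of_eq_zero_right (a := 0) (b := T) (K := ‖A‖)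
    (fun t _ => (hyd t).continuousAt.continuousWithinAt) (fun t _ => (hyd t).hasDerivWithinAt)
    (by simp [hy]) (fun t ht => ?_) t₀ ht₀
  rw [hyw t ⟨ht.1, ht.2.le⟩, hcw t ⟨ht.1, ht.2.le⟩]
  exact A.le_opNorm _

theorem integrable_integral_smul_comp_sub {v : ℝ → ℂ} {g : ℝ → X} (hv : Integrable v)
    (hg : Integrable g) : Integrable fun t => ∫ s, v s • g (t - s) :=
  (hv.convolution_integrand (ContinuousLinearMap.lsmul ℂ ℂ) hg).integral_prod_left

/-- Duhamel's formula for the inhomogeneous equation `B W' = L W + v D` when `g` is the fundamental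
solution. -/
theorem duhamel_formula [CompleteSpace X] (B L : X →L[ℂ] X) (D : X) {T : ℝ} {v : ℝ → ℂ} {g : ℝ → X}
    (hv : Integrable v) (hg : Integrable g) (hv0 : ∀ s ≤ 0, v s = 0) (hg0 : ∀ r ≤ 0, g r = 0)
    (hint : ∀ t, Integrable fun s => v s • g (t - s))
    (hgD : ∀ r ∈ Ioc 0 T, B (g r) = D + ∫ σ in (0 : ℝ)..r, L (g σ)) {t : ℝ} (ht : t ∈ Icc 0 T) :
    B (∫ s, v s • g (t - s)) =
      (∫ τ in (0 : ℝ)..t, L (∫ s, v s • g (τ - s))) + (∫ s in (0 : ℝ)..t, v s) • D := by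
  have hLg : Integrable fun r => L (g r) := L.integrable_comp hg
  -- After Fubini, the inner integral for fixed `s` is `∫ L g` over `(-s, t - s)`. For `0 < s < t`
  -- it equals `B g(t - s) - D`, where `D` is the initial value of the fundamental solution;
  -- otherwise `v s` or `g` on the whole range vanishes.
  have inner_eq : ∀ s, ∫ τ in Ioc 0 t, v s • L (g (τ - s)) =
      v s • B (g (t - s)) - (Ioo 0 t).indicator v s • D := by
    intro s
    rw [integral_smul, ← intervalIntegral.integral_of_le ht.1,
      intervalIntegral.integral_comp_sub_right (fun r => L (g r)) s, zero_sub]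
    have zero_of_nonpos : ∀ a b : ℝ, a ≤ 0 → b ≤ 0 → ∫ r in a..b, L (g r) = 0 := by
      intro a b ha hb
      rw [← intervalIntegral.integral_zero (a := a) (b := b) (μ := volume) (E := X)]
      refine intervalIntegral.integral_congr fun r hr => ?_
      have : r ≤ 0 := hr.2.trans (max_le ha hb)
      simp [hg0 r this]
    rcases le_or_gt s 0 with hs | hs
    · have : s ∉ Ioo 0 t := fun h => h.1.not_ge hs
      simp [hv0 s hs, this]
    rcases lt_or_ge s t with hst | hst
    · rw [indicator_of_mem (show s ∈ Ioo 0 t from ⟨hs, hst⟩),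
        ← intervalIntegral.integral_add_adjacent_intervals (b := 0) hLg.intervalIntegrable
          hLg.intervalIntegrable, zero_of_nonpos _ _ (by linarith) le_rfl, zero_add,
        hgD (t - s) ⟨by linarith, by linarith [ht.2]⟩, smul_add]
      abel
    · have : s ∉ Ioo 0 t := fun h => h.2.not_ge hst
      rw [zero_of_nonpos _ _ (by linarith) (by linarith), indicator_of_notMem this,
        hg0 (t - s) (by linarith)]
      simp
  have hprod : Integrable (Function.uncurry fun τ s => v s • L (g (τ - s)))
      ((volume.restrict (Ioc 0 t)).prod volume) := by
    have h := hv.convolution_integrand (μ := volume) (ContinuousLinearMap.lsmul ℂ ℂ) hLg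
    refine h.mono_measure ?_
    exact Measure.prod_mono Measure.restrict_le_self le_rfl
  have hBint : Integrable fun s => v s • B (g (t - s)) := by
    simpa using B.integrable_comp (hint t)
  have hIoo : Integrable fun s => (Ioo 0 t).indicator v s • D :=
    (hv.indicator measurableSet_Ioo).smul_const D
  have hL : ∫ τ in (0 : ℝ)..t, L (∫ s, v s • g (τ - s)) =
      B (∫ s, v s • g (t - s)) - (∫ s in (0 : ℝ)..t, v s) • D := by
    calc ∫ τ in (0 : ℝ)..t, L (∫ s, v s • g (τ - s))
        = ∫ τ in Ioc 0 t, ∫ s, v s • L (g (τ - s)) := by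
          rw [intervalIntegral.integral_of_le ht.1]
          congr 1
          ext τ
          rw [← L.integral_comp_comm (hint τ)]
          simp
      _ = ∫ s, ∫ τ in Ioc 0 t, v s • L (g (τ - s)) := integral_integral_swap hprod
      _ = ∫ s, (v s • B (g (t - s)) - (Ioo 0 t).indicator v s • D) := by simp_rw [inner_eq]
      _ = _ := by
          rw [integral_sub hBint hIoo, integral_smul_const, integral_indicator measurableSet_Ioo,
            intervalIntegral.integral_of_le ht.1, integral_Ioc_eq_integral_Ioo,
            ← B.integral_comp_comm (hint t)]
          simp
  rw [hL]
  abel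

end Abstract

/-! ### Uniqueness of solutions by frequency cutoff. -/

/-- The ball of radius `n` as a symbol. -/
def cutoff (n : ℕ) : Plane → ℂ := (Metric.closedBall (0 : Plane) n).indicator 1

theorem memLp_cutoff (n : ℕ) : MemLp (cutoff n) ∞ (volume : Measure Plane) := by
  refine memLp_top_of_bound ?_ 1 (.of_forall fun x => ?_)
  · exact (aestronglyMeasurable_const (b := (1 : ℂ))).indicator Metric.isClosed_closedBall.measurableSet
  · by_cases hx : x ∈ Metric.closedBall (0 : Plane) n <;> simp [cutoff, indicator, hx]

theorem memLp_cutoff_heatSymbol (n : ℕ) :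
    MemLp (fun x => -(heatSymbol x : ℂ) * cutoff n x) ∞ (volume : Measure Plane) := by
  refine memLp_top_of_bound ?_ ((2 * Real.pi) ^ 2 * (n : ℝ) ^ 2) (.of_forall fun x => ?_)
  · exact (Complex.continuous_ofReal.comp continuous_heatSymbol).neg.aestronglyMeasurable.mul
      (memLp_cutoff n).1
  · by_cases hx : x ∈ Metric.closedBall (0 : Plane) n
    · have : ‖x‖ ≤ n := by simpa using hx
      rw [cutoff, indicator_of_mem hx, Pi.one_apply, mul_one, norm_neg, Complex.norm_real,
        Real.norm_of_nonneg (heatSymbol_nonneg x), heatSymbol]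
      gcongr
    · simp only [cutoff, indicator_of_notMem hx, mul_zero, norm_zero]
      positivity

theorem eq_of_fourier_eq {f g : L2Plane} (h : 𝓕 f = 𝓕 g) : f = g := by
  have := congrArg (fun f : L2Plane => 𝓕⁻ f) h
  simpa using this

/-- As the cutoff is idempotent, it can be shared between the two factors of `laplaceSymbol`. On low
frequencies `-4π²|ξ|²` is bounded, so the truncated equation closes up as an ODE with a bounded
generator. -/
theorem cutoff_laplaceOp (n : ℕ) (f : L2Plane) :
    fourierMul _ (memLp_cutoff n) (laplaceOp f) =
      fourierMul _ (memLp_cutoff_heatSymbol n) (fourierMul _ (memLp_cutoff n) (besselOp f)) := by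
  apply eq_of_fourier_eq
  simp only [laplaceOp, besselOp, fourier_fourierMul]
  apply Lp.ext
  filter_upwards [coeFn_mulOp (memLp_cutoff n) (mulOp _ memLp_top_laplaceSymbol (𝓕 f)),
    coeFn_mulOp memLp_top_laplaceSymbol (𝓕 f), coeFn_mulOp memLp_top_besselSymbol (𝓕 f),
    coeFn_mulOp (memLp_cutoff n) (mulOp _ memLp_top_besselSymbol (𝓕 f)),
    coeFn_mulOp (memLp_cutoff_heatSymbol n)
      (mulOp _ (memLp_cutoff n) (mulOp _ memLp_top_besselSymbol (𝓕 f)))] with x h1 h2 h3 h4 h5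
  rw [h1, h2, h5, h4, h3, laplaceSymbol]
  by_cases hx : x ∈ Metric.closedBall (0 : Plane) n <;> simp [cutoff, indicator, hx, mul_assoc]

/-- The balls exhaust the plane and the Bessel symbol has no zeros. -/
theorem eq_zero_of_cutoff_besselOp {f : L2Plane}
    (h : ∀ n, fourierMul _ (memLp_cutoff n) (besselOp f) = 0) : f = 0 := by
  apply eq_of_fourier_eq
  have h0 : 𝓕 (0 : L2Plane) = 0 := map_zero (fourierCLM ℂ L2Plane)
  rw [h0]
  have h' : ∀ n, mulOp _ (memLp_cutoff n) (mulOp _ memLp_top_besselSymbol (𝓕 f)) = 0 := by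
    intro n
    rw [← fourier_fourierMul, ← fourier_fourierMul]
    exact (congrArg (fun f : L2Plane => 𝓕 f) (h n)).trans h0
  apply Lp.ext
  have hall : ∀ᵐ x : Plane, ∀ n : ℕ, cutoff n x * (besselSymbol x * (𝓕 f : L2Plane) x) = 0 := by
    rw [ae_all_iff]
    intro n
    filter_upwards [coeFn_mulOp (memLp_cutoff n) (mulOp _ memLp_top_besselSymbol (𝓕 f)),
      coeFn_mulOp memLp_top_besselSymbol (𝓕 f), Lp.coeFn_zero ℂ 2 (volume : Measure Plane)]
      with x h1 h2 h3
    rw [← h2, ← h1, h' n, h3]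
    rfl
  filter_upwards [hall, Lp.coeFn_zero ℂ 2 (volume : Measure Plane)] with x hx h3
  rw [h3]
  obtain ⟨n, hn⟩ := exists_nat_ge ‖x‖
  have hx' := hx n
  rw [cutoff, indicator_of_mem (by simpa using hn)] at hx'
  simpa [besselSymbol_ne_zero] using hx'

/-- The control term cancels in the difference of two solutions, whose low-frequency parts solve a
homogeneous linear ODE with zero initial value. -/
theorem IsSolution.eqOn {T : ℝ} (hT : 0 < T) {u : ℝ → ℂ} {W₀ : L2Plane} {V W : ℝ → L2Plane}
    (hV : IsSolution T u W₀ V) (hW : IsSolution T u W₀ W) : EqOn V W (Icc 0 T) := by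
  obtain ⟨-, hV0, Z₁, hZ₁, hV1, hV2⟩ := isSolution_iff.1 hV
  obtain ⟨-, hW0, Z₂, hZ₂, hW1, hW2⟩ := isSolution_iff.1 hW
  intro t₀ ht₀
  rw [← sub_eq_zero]
  refine eq_zero_of_cutoff_besselOp fun n => ?_
  set P := fourierMul _ (memLp_cutoff n)
  set A := fourierMul _ (memLp_cutoff_heatSymbol n)
  have hint : ∀ t ∈ Icc 0 T, IntervalIntegrable Z₁ volume 0 t ∧ IntervalIntegrable Z₂ volume 0 t := by
    intro t ht
    have : uIcc 0 t ⊆ uIcc 0 T := by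
      rw [uIcc_of_le ht.1, uIcc_of_le hT.le]
      exact Icc_subset_Icc_right ht.2
    exact ⟨hZ₁.mono_set this, hZ₂.mono_set this⟩
  have hB : ∀ t ∈ Icc 0 T, P (besselOp (V t - W t)) =
      ∫ s in (0 : ℝ)..t, P (Z₁ s - Z₂ s) := by
    intro t ht
    rw [P.intervalIntegral_comp_comm ((hint t ht).1.sub (hint t ht).2),
      intervalIntegral.integral_sub (hint t ht).1 (hint t ht).2, map_sub besselOp, hV2 t ht,
      hW2 t ht, hV0, hW0, add_sub_add_left_eq_sub]
  refine eq_zero_of_eq_integral A (w := fun t => P (besselOp (V t - W t))) (T := T) ?_ ?_ t₀ ht₀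
  · have hc : ContinuousOn (fun t => ∫ s in (0 : ℝ)..t, P (Z₁ s - Z₂ s)) (Icc 0 T) := by
      have h := intervalIntegral.continuousOn_primitive_interval' (a := 0) (b₁ := 0) (b₂ := T)
        (μ := volume) (f := fun s => P (Z₁ s - Z₂ s)) ?_ left_mem_uIcc
      · rwa [uIcc_of_le hT.le] at h
      · have := hZ₁.sub hZ₂
        rw [intervalIntegrable_iff] at this ⊢
        exact P.integrable_comp this
    exact hc.congr hB
  · intro t ht
    rw [hB t ht]
    refine intervalIntegral.integral_congr_ae ?_
    rw [uIoc_of_le ht.1]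
    have h1 := (ae_restrict_iff' measurableSet_Ioo).1 hV1
    have h2 := (ae_restrict_iff' measurableSet_Ioo).1 hW1
    have h3 : ∀ᵐ s : ℝ, s ≠ T := by simp [ae_iff]
    filter_upwards [h1, h2, h3] with s hs1 hs2 hs3 hs
    have hs' : s ∈ Ioo 0 T := ⟨hs.1, lt_of_le_of_ne (hs.2.trans ht.2) hs3⟩
    rw [hs1 hs', hs2 hs', sub_sub_sub_cancel_right, ← map_sub]
    exact cutoff_laplaceOp n _

/-! ### The heat kernel as a fundamental solution. -/

/-- The heat kernel of the plane at time `t`. -/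
def heatKernelFun (t : ℝ) (x : Plane) : ℝ :=
  (4 * Real.pi * t)⁻¹ * Real.exp (-(4 * t)⁻¹ * ‖x‖ ^ 2)

theorem continuous_heatKernelFun (t : ℝ) : Continuous (heatKernelFun t) := by
  unfold heatKernelFun; fun_prop

theorem integrable_exp_neg_mul_sq_norm {b : ℝ} (hb : 0 < b) :
    Integrable fun x : Plane => Real.exp (-b * ‖x‖ ^ 2) := by
  -- The integral of a non-integrable function is `0` by convention, whereas the Gaussian integral
  -- formula gives a positive value.
  by_contra h
  have h1 := GaussianFourier.integral_rexp_neg_mul_sq_norm (V := Plane) hb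
  rw [integral_undef h] at h1
  have : 0 < (Real.pi / b) ^ ((Module.finrank ℝ Plane : ℝ) / 2) := by positivity
  exact this.ne h1

theorem integral_exp_neg_mul_sq_norm {b : ℝ} (hb : 0 < b) :
    ∫ x : Plane, Real.exp (-b * ‖x‖ ^ 2) = Real.pi / b := by
  rw [GaussianFourier.integral_rexp_neg_mul_sq_norm hb]
  simp

theorem heatKernelFun_mul (s t : ℝ) (x : Plane) : heatKernelFun s x * heatKernelFun t x =
    ((4 * Real.pi * s)⁻¹ * (4 * Real.pi * t)⁻¹) *
      Real.exp (-((4 * s)⁻¹ + (4 * t)⁻¹) * ‖x‖ ^ 2) := by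
  unfold heatKernelFun
  rw [neg_add, add_mul, Real.exp_add]
  ring

/-- This is the semigroup law `K_s * K_t = K_{s+t}` evaluated at the origin. It yields all norms and
inner products of heat kernels. -/
theorem integral_heatKernelFun_mul {s t : ℝ} (hs : 0 < s) (ht : 0 < t) :
    ∫ x : Plane, heatKernelFun s x * heatKernelFun t x = (4 * Real.pi * (s + t))⁻¹ := by
  simp_rw [heatKernelFun_mul]
  rw [integral_const_mul, integral_exp_neg_mul_sq_norm (by positivity)]
  have := Real.pi_pos
  field_simp
  ring

theorem integrable_heatKernelFun {t : ℝ} (ht : 0 < t) : Integrable (heatKernelFun t) :=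
  (integrable_exp_neg_mul_sq_norm (by positivity)).const_mul _

theorem memLp_heatKernelFun {t : ℝ} (ht : 0 < t) :
    MemLp (fun x => (heatKernelFun t x : ℂ)) 2 (volume : Measure Plane) := by
  have hcont : Continuous fun x => (heatKernelFun t x : ℂ) :=
    Complex.continuous_ofReal.comp (continuous_heatKernelFun t)
  rw [memLp_two_iff_integrable_sq_norm hcont.aestronglyMeasurable]
  have h : Integrable fun x : Plane => heatKernelFun t x * heatKernelFun t x := by
    simp_rw [heatKernelFun_mul]
    exact (integrable_exp_neg_mul_sq_norm (by positivity)).const_mul _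
  refine h.congr (.of_forall fun x => ?_)
  simp [Complex.norm_real, sq]

/-- The heat kernel as a function of time with values in `L²(ℝ²)`, extended by `0` to `t ≤ 0`. -/
def heatKernel (t : ℝ) : L2Plane :=
  if ht : 0 < t then (memLp_heatKernelFun ht).toLp _ else 0

theorem coeFn_heatKernel {t : ℝ} (ht : 0 < t) :
    heatKernel t =ᵐ[volume] fun x => (heatKernelFun t x : ℂ) := by
  rw [heatKernel, dif_pos ht]
  exact MemLp.coeFn_toLp _

theorem inner_heatKernel {s t : ℝ} (hs : 0 < s) (ht : 0 < t) :
    inner ℂ (heatKernel s) (heatKernel t) = (((4 * Real.pi * (s + t))⁻¹ : ℝ) : ℂ) := by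
  rw [L2.inner_def, ← integral_heatKernelFun_mul hs ht, ← integral_complex_ofReal]
  refine integral_congr_ae ?_
  filter_upwards [coeFn_heatKernel hs, coeFn_heatKernel ht] with x h1 h2
  rw [h1, h2]
  simp [mul_comm]

theorem norm_heatKernel_sq {t : ℝ} (ht : 0 < t) :
    ‖heatKernel t‖ ^ 2 = (4 * Real.pi * (t + t))⁻¹ := by
  have h := inner_heatKernel ht ht
  rw [← inner_self_eq_norm_sq (𝕜 := ℂ), h]
  exact Complex.ofReal_re _

/-- Expanding `‖K(t) - K(t₀)‖²` by the explicit inner products gives a continuous function of `t`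
that vanishes at `t₀`. -/
theorem continuousOn_heatKernel : ContinuousOn heatKernel (Ioi 0) := by
  intro t₀ ht₀
  refine ContinuousAt.continuousWithinAt ?_
  have ht₀' : (0 : ℝ) < t₀ := ht₀
  rw [ContinuousAt, tendsto_iff_norm_sub_tendsto_zero]
  have hsq : Tendsto (fun t => ‖heatKernel t - heatKernel t₀‖ ^ 2) (𝓝 t₀) (𝓝 0) := by
    have hev : (fun t => ‖heatKernel t - heatKernel t₀‖ ^ 2) =ᶠ[𝓝 t₀] fun t =>
        (4 * Real.pi * (t + t))⁻¹ - 2 * (4 * Real.pi * (t + t₀))⁻¹ +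
          (4 * Real.pi * (t₀ + t₀))⁻¹ := by
      filter_upwards [Ioi_mem_nhds ht₀'] with t ht
      rw [norm_sub_sq (𝕜 := ℂ), norm_heatKernel_sq ht, norm_heatKernel_sq ht₀',
        inner_heatKernel ht ht₀']
      congr 3
    rw [tendsto_congr' hev]
    have hpi := Real.pi_pos
    have hc : ContinuousAt (fun t => (4 * Real.pi * (t + t))⁻¹ - 2 * (4 * Real.pi * (t + t₀))⁻¹ +
          (4 * Real.pi * (t₀ + t₀))⁻¹) t₀ := by
      have : 4 * Real.pi * (t₀ + t₀) ≠ 0 := by positivity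
      fun_prop (disch := assumption)
    have := hc.tendsto
    convert this using 2
    ring
  have := (Real.continuous_sqrt.tendsto 0).comp hsq
  simpa [Function.comp_def, Real.sqrt_sq (norm_nonneg _)] using this

/-- `‖K(t)‖ = (8πt)^(-1/2) ≤ t^(-1/2)`, which is integrable at `0`. -/
theorem integrableOn_heatKernel (T : ℝ) : IntegrableOn heatKernel (Ioc 0 T) := by
  have hmeas : AEStronglyMeasurable heatKernel (volume.restrict (Ioc 0 T)) :=
    (continuousOn_heatKernel.mono fun t ht => ht.1).aestronglyMeasurable measurableSet_Ioc
  have hint : IntegrableOn (fun t : ℝ => t ^ (-(1 / 2) : ℝ)) (Ioc 0 T) := by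
    rcases le_or_gt 0 T with hT | hT
    · rw [← intervalIntegrable_iff_integrableOn_Ioc_of_le hT]
      exact intervalIntegral.intervalIntegrable_rpow' (by norm_num)
    · simp [Ioc_eq_empty hT.not_gt]
  refine Integrable.mono' hint hmeas ?_
  filter_upwards [ae_restrict_mem measurableSet_Ioc] with t ht
  have hsq : ‖heatKernel t‖ ^ 2 ≤ (t ^ (-(1 / 2) : ℝ)) ^ 2 := by
    rw [norm_heatKernel_sq ht.1, ← Real.rpow_natCast, ← Real.rpow_mul ht.1.le]
    rw [show -(1 / 2) * ((2 : ℕ) : ℝ) = -1 by norm_num, Real.rpow_neg_one]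
    refine inv_anti₀ ht.1 ?_
    nlinarith [Real.pi_gt_three, ht.1]
  exact (sq_le_sq₀ (norm_nonneg _) (Real.rpow_nonneg ht.1.le _)).1 hsq

theorem memLp_exp_heatSymbol {t : ℝ} (ht : 0 < t) :
    MemLp (fun x => (Real.exp (-t * heatSymbol x) : ℂ)) 2 (volume : Measure Plane) := by
  have hcont : Continuous fun x => (Real.exp (-t * heatSymbol x) : ℂ) := by
    have := continuous_heatSymbol
    fun_prop
  rw [memLp_two_iff_integrable_sq_norm hcont.aestronglyMeasurable]
  have h := integrable_exp_neg_mul_sq_norm (b := 2 * t * (2 * Real.pi) ^ 2) (by positivity)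
  refine h.congr (.of_forall fun x => ?_)
  simp only [Complex.norm_real, Real.norm_of_nonneg (Real.exp_nonneg _), ← Real.exp_nat_mul,
    heatSymbol]
  congr 1
  push_cast
  ring

theorem fourier_heatKernelFun {t : ℝ} (ht : 0 < t) (ξ : Plane) :
    𝓕 (fun x => (heatKernelFun t x : ℂ)) ξ = (Real.exp (-t * heatSymbol ξ) : ℂ) := by
  have h := fourier_gaussian_innerProductSpace (b := (((4 * t)⁻¹ : ℝ) : ℂ)) (V := Plane)
    (by rw [Complex.ofReal_re]; positivity) ξ
  have h2 : (fun x : Plane => (heatKernelFun t x : ℂ)) =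
      ((4 * Real.pi * t : ℝ) : ℂ)⁻¹ •
        fun x : Plane => Complex.exp (-(((4 * t)⁻¹ : ℝ) : ℂ) * (‖x‖ : ℂ) ^ 2) := by
    ext x
    simp [heatKernelFun]
  have hpi := Real.pi_pos
  have htc : (t : ℂ) ≠ 0 := by exact_mod_cast ht.ne'
  have hpc : (Real.pi : ℂ) ≠ 0 := by exact_mod_cast hpi.ne'
  have hsm : 𝓕 (((4 * Real.pi * t : ℝ) : ℂ)⁻¹ •
        fun x : Plane => Complex.exp (-(((4 * t)⁻¹ : ℝ) : ℂ) * (‖x‖ : ℂ) ^ 2)) ξ =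
      ((4 * Real.pi * t : ℝ) : ℂ)⁻¹ •
        𝓕 (fun x : Plane => Complex.exp (-(((4 * t)⁻¹ : ℝ) : ℂ) * (‖x‖ : ℂ) ^ 2)) ξ := by
    simp only [Real.fourier_eq, Pi.smul_apply]
    rw [← integral_smul]
    congr 1
    ext x
    rw [smul_comm]
  rw [h2, hsm, h]
  have hfr : ((Module.finrank ℝ Plane : ℂ) / 2) = 1 := by simp
  rw [hfr, Complex.cpow_one, smul_eq_mul, ← mul_assoc, heatSymbol]
  have h3 : ((4 * Real.pi * t : ℝ) : ℂ)⁻¹ * (Real.pi / (((4 * t)⁻¹ : ℝ) : ℂ)) = 1 := by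
    push_cast
    field_simp
  rw [h3, one_mul, Complex.ofReal_exp]
  congr 1
  push_cast
  field_simp
  ring

/-- The kernel is also in `L¹`, so moving the transform onto Schwartz test functions identifies its
`L²` Fourier transform with the integral one. -/
theorem fourier_heatKernel {t : ℝ} (ht : 0 < t) :
    (𝓕 (heatKernel t) : L2Plane) = (memLp_exp_heatSymbol ht).toLp _ := by
  apply toTemperedDistribution_injective
  simp only
  rw [← Lp.fourier_toTemperedDistribution_eq]
  ext φ
  rw [TemperedDistribution.fourier_apply, Lp.toTemperedDistribution_apply,
    Lp.toTemperedDistribution_apply]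
  have h1 : ∫ x, (𝓕 φ) x • heatKernel t x = ∫ x, 𝓕 (⇑φ) x • (heatKernelFun t x : ℂ) := by
    refine integral_congr_ae ?_
    filter_upwards [coeFn_heatKernel ht] with x hx
    rw [hx, SchwartzMap.fourier_coe]
  have h2 : ∫ x, φ x • ((memLp_exp_heatSymbol ht).toLp _ : L2Plane) x =
      ∫ x, φ x • 𝓕 (fun x => (heatKernelFun t x : ℂ)) x := by
    refine integral_congr_ae ?_
    filter_upwards [(memLp_exp_heatSymbol ht).coeFn_toLp] with x hx
    rw [hx, fourier_heatKernelFun ht]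
  rw [h1, h2]
  simpa using! (VectorFourier.integral_fourierIntegral_smul_eq_flip (L := innerₗ Plane)
      Real.continuous_fourierChar continuous_inner φ.integrable
      (integrable_heatKernelFun ht).ofReal)

theorem integral_neg_mul_exp (a t : ℝ) :
    ∫ s in (0 : ℝ)..t, -a * Real.exp (-s * a) = Real.exp (-t * a) - 1 := by
  have h : ∀ s ∈ uIcc 0 t, HasDerivAt (fun s => Real.exp (-s * a)) (-a * Real.exp (-s * a)) s := by
    intro s _
    have := ((hasDerivAt_neg s).mul_const a).exp
    convert this using 1
    ring
  rw [intervalIntegral.integral_eq_sub_of_hasDerivAt h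
    ((by fun_prop : Continuous fun s => -a * Real.exp (-s * a)).intervalIntegrable _ _)]
  simp

/-- The heat equation for the heat kernel, integrated in time from the initial value `δ`. -/
theorem besselOp_heatKernel {t : ℝ} (ht : 0 < t) :
    besselOp (heatKernel t) = besselDelta + ∫ s in (0 : ℝ)..t, laplaceOp (heatKernel s) := by
  have hLint : IntervalIntegrable (fun s => laplaceOp (heatKernel s)) volume 0 t := by
    rw [intervalIntegrable_iff_integrableOn_Ioc_of_le ht.le]
    exact laplaceOp.integrable_comp (integrableOn_heatKernel t)
  apply eq_of_fourier_eq
  have hF : 𝓕 (besselDelta + ∫ s in (0 : ℝ)..t, laplaceOp (heatKernel s)) =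
      memLp_two_besselSymbol.toLp besselSymbol +
        ∫ s in (0 : ℝ)..t, (𝓕 (laplaceOp (heatKernel s)) : L2Plane) := by
    have h1 := (fourierCLM ℂ L2Plane).intervalIntegral_comp_comm hLint
    simp only [fourierCLM_apply] at h1
    rw [h1, FourierTransform.fourier_add, besselDelta, fourier_fourierInv_eq]
  have hFint : IntervalIntegrable (fun s => (𝓕 (laplaceOp (heatKernel s)) : L2Plane)) volume 0 t := by
    rw [intervalIntegrable_iff] at hLint ⊢
    exact (fourierCLM ℂ L2Plane).integrable_comp hLint
  rw [hF]
  -- Pairing with an arbitrary `ψ` reduces the `L²`-valued integral to scalar ones, to which Fubini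
  -- applies.
  refine ext_inner_left ℂ fun ψ => ?_
  have hI : inner ℂ ψ (∫ s in (0 : ℝ)..t, (𝓕 (laplaceOp (heatKernel s)) : L2Plane)) =
      ∫ s in (0 : ℝ)..t, inner ℂ ψ (𝓕 (laplaceOp (heatKernel s)) : L2Plane) := by
    have h := (innerSL ℂ ψ).intervalIntegral_comp_comm hFint
    simp only [innerSL_apply_apply] at h
    exact h.symm
  rw [inner_add_right, hI]
  set k : Plane → ℂ := fun x => besselSymbol x * (starRingEnd ℂ) (ψ x) with hk
  have hkint : Integrable k := memLp_two_besselSymbol.integrable_mul (Lp.memLp ψ).star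
  have e1 : inner ℂ ψ (𝓕 (besselOp (heatKernel t)) : L2Plane) =
      ∫ x, (Real.exp (-t * heatSymbol x) : ℂ) * k x := by
    rw [L2.inner_def, besselOp, fourier_fourierMul, fourier_heatKernel ht]
    refine integral_congr_ae ?_
    filter_upwards [coeFn_mulOp memLp_top_besselSymbol ((memLp_exp_heatSymbol ht).toLp _),
      (memLp_exp_heatSymbol ht).coeFn_toLp] with x h1 h2
    rw [h1, h2, RCLike.inner_apply, hk]
    ring
  have e2 : inner ℂ ψ (memLp_two_besselSymbol.toLp besselSymbol) = ∫ x, k x := by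
    rw [L2.inner_def]
    refine integral_congr_ae ?_
    filter_upwards [memLp_two_besselSymbol.coeFn_toLp] with x h1
    rw [h1, RCLike.inner_apply]
  have e3 : ∀ s ∈ Ioc 0 t, inner ℂ ψ (𝓕 (laplaceOp (heatKernel s)) : L2Plane) =
      ∫ x, ((-heatSymbol x * Real.exp (-s * heatSymbol x) : ℝ) : ℂ) * k x := by
    intro s hs
    rw [L2.inner_def, laplaceOp, fourier_fourierMul, fourier_heatKernel hs.1]
    refine integral_congr_ae ?_
    filter_upwards [coeFn_mulOp memLp_top_laplaceSymbol ((memLp_exp_heatSymbol hs.1).toLp _),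
      (memLp_exp_heatSymbol hs.1).coeFn_toLp] with x h1 h2
    rw [h1, h2, RCLike.inner_apply, hk, laplaceSymbol]
    push_cast
    ring
  have hcont : Continuous fun p : ℝ × Plane =>
      ((-heatSymbol p.2 * Real.exp (-p.1 * heatSymbol p.2) : ℝ) : ℂ) := by
    have := continuous_heatSymbol
    fun_prop
  have hprod : Integrable (Function.uncurry fun (s : ℝ) (x : Plane) =>
      ((-heatSymbol x * Real.exp (-s * heatSymbol x) : ℝ) : ℂ) * k x)
      ((volume.restrict (Ioc 0 t)).prod volume) := by
    have hmeas : AEStronglyMeasurable (Function.uncurry fun (s : ℝ) (x : Plane) =>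
        ((-heatSymbol x * Real.exp (-s * heatSymbol x) : ℝ) : ℂ) * k x)
        ((volume.restrict (Ioc 0 t)).prod volume) :=
      hcont.aestronglyMeasurable.mul hkint.1.comp_snd
    rw [integrable_prod_iff' hmeas]
    constructor
    · refine .of_forall fun x => ?_
      have hc : Continuous fun s : ℝ =>
          ((-heatSymbol x * Real.exp (-s * heatSymbol x) : ℝ) : ℂ) * k x := by fun_prop
      exact hc.integrableOn_Ioc
    -- With `a = heatSymbol x`, the time integral of `a e^{-sa}` is `1 - e^{-ta} ≤ 1`. So `‖k‖`
    -- dominates although `a` is unbounded in `x`.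
    · have hval : ∀ x, ∫ s in Ioc 0 t, ‖Function.uncurry (fun (s : ℝ) (x : Plane) =>
          ((-heatSymbol x * Real.exp (-s * heatSymbol x) : ℝ) : ℂ) * k x) (s, x)‖ =
          (1 - Real.exp (-t * heatSymbol x)) * ‖k x‖ := by
        intro x
        rw [← neg_sub, ← integral_neg_mul_exp, intervalIntegral.integral_of_le ht.le, ← integral_neg,
          ← integral_mul_const]
        refine integral_congr_ae (.of_forall fun s => ?_)
        simp only [Function.uncurry, norm_mul, Complex.norm_real, norm_neg, neg_mul, neg_neg]
        rw [Real.norm_of_nonneg (heatSymbol_nonneg x), Real.norm_of_nonneg (Real.exp_nonneg _)]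
      simp_rw [hval]
      refine hkint.norm.mono' ?_ (.of_forall fun x => ?_)
      · have : Continuous fun x => 1 - Real.exp (-t * heatSymbol x) := by
          have := continuous_heatSymbol
          fun_prop
        exact this.aestronglyMeasurable.mul hkint.1.norm
      · have h1 : Real.exp (-t * heatSymbol x) ≤ 1 :=
          Real.exp_le_one_iff.2 (by nlinarith [heatSymbol_nonneg x])
        rw [norm_mul, norm_norm, Real.norm_of_nonneg (by linarith)]
        exact mul_le_of_le_one_left (norm_nonneg _) (by linarith [Real.exp_nonneg (-t * heatSymbol x)])
  have e4 : ∫ s in (0 : ℝ)..t, inner ℂ ψ (𝓕 (laplaceOp (heatKernel s)) : L2Plane) =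
      ∫ x, ((Real.exp (-t * heatSymbol x) : ℂ) - 1) * k x := by
    rw [intervalIntegral.integral_of_le ht.le, setIntegral_congr_fun measurableSet_Ioc e3,
      integral_integral_swap hprod]
    congr 1
    ext x
    rw [integral_mul_const, integral_complex_ofReal, ← intervalIntegral.integral_of_le ht.le,
      integral_neg_mul_exp]
    push_cast
    rfl
  have hexpint : Integrable fun x => (Real.exp (-t * heatSymbol x) : ℂ) * k x := by
    refine hkint.bdd_mul (c := 1) ?_ (.of_forall fun x => ?_)
    · have : Continuous fun x => (Real.exp (-t * heatSymbol x) : ℂ) := by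
        have := continuous_heatSymbol
        fun_prop
      exact this.aestronglyMeasurable
    · rw [Complex.norm_real, Real.norm_of_nonneg (Real.exp_nonneg _)]
      exact Real.exp_le_one_iff.2 (by nlinarith [heatSymbol_nonneg x])
  rw [e1, e2, e4]
  simp_rw [sub_mul, one_mul]
  rw [integral_sub hexpint hkint]
  ring

/-! ### Radial functions. -/

/-- The image of the Lebesgue measure of the plane under `x ↦ |x|²`. -/
def normSqMeasure : Measure ℝ := ENNReal.ofReal Real.pi • volume.restrict (Ioi (0 : ℝ))

theorem integral_normSqMeasure (f : ℝ → ℂ) :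
    ∫ r, f r ∂normSqMeasure = Real.pi • ∫ r in Ioi (0 : ℝ), f r := by
  rw [normSqMeasure, integral_smul_measure, ENNReal.toReal_ofReal Real.pi_pos.le]

/-- The disc `|x|² ≤ b` has area `πb`, and half-open intervals determine the measure. This is why
the variable `|x|²` leads to an unweighted `L²(0, ∞)`. -/
theorem measurePreserving_norm_sq :
    MeasurePreserving (fun x : Plane => ‖x‖ ^ 2) volume normSqMeasure := by
  have hm : Measurable fun x : Plane => ‖x‖ ^ 2 := by fun_prop
  refine ⟨hm, ?_⟩
  have h1 : ∀ b, Measure.map (fun x : Plane => ‖x‖ ^ 2) volume (Iic b) =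
      ENNReal.ofReal b * ENNReal.ofReal Real.pi := by
    intro b
    rw [Measure.map_apply hm measurableSet_Iic]
    rcases le_or_gt 0 b with hb | hb
    · have : (fun x : Plane => ‖x‖ ^ 2) ⁻¹' Iic b = Metric.closedBall 0 (Real.sqrt b) := by
        ext x
        simp [Real.le_sqrt (norm_nonneg x) hb]
      rw [this, EuclideanSpace.volume_closedBall_fin_two, ← ENNReal.ofReal_pow (Real.sqrt_nonneg b),
        Real.sq_sqrt hb]
    · have : (fun x : Plane => ‖x‖ ^ 2) ⁻¹' Iic b = ∅ := by
        ext x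
        simp only [mem_preimage, mem_Iic, mem_empty_iff_false, iff_false, not_le]
        exact hb.trans_le (by positivity)
      rw [this, ENNReal.ofReal_of_nonpos hb.le]
      simp
  have h2 : ∀ b, normSqMeasure (Iic b) = ENNReal.ofReal b * ENNReal.ofReal Real.pi := by
    intro b
    rw [normSqMeasure, Measure.smul_apply, Measure.restrict_apply measurableSet_Iic,
      inter_comm, Ioi_inter_Iic, Real.volume_Ioc, sub_zero, smul_eq_mul, mul_comm]
  have hfin : ∀ b, ENNReal.ofReal b * ENNReal.ofReal Real.pi ≠ ∞ := fun b =>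
    ENNReal.mul_ne_top ENNReal.ofReal_ne_top ENNReal.ofReal_ne_top
  refine Measure.ext_of_Ioc' _ _ (fun a b hab => ?_) fun a b hab => ?_
  · refine ne_top_of_le_ne_top (hfin b) ?_
    rw [← h1]
    exact measure_mono Ioc_subset_Iic_self
  · have hd : Ioc a b = Iic b \ Iic a := by
      ext r
      simp [and_comm]
    rw [hd, measure_sdiff (Iic_subset_Iic.2 hab.le) measurableSet_Iic.nullMeasurableSet
      (by rw [h1]; exact hfin a), measure_sdiff (Iic_subset_Iic.2 hab.le)
      measurableSet_Iic.nullMeasurableSet (by rw [h2]; exact hfin a), h1, h1, h2, h2]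

/-- The isometry `g ↦ g(|x|²)`. -/
def radialMap : Lp ℂ 2 normSqMeasure →ₗᵢ[ℂ] L2Plane :=
  Lp.compMeasurePreservingₗᵢ ℂ _ measurePreserving_norm_sq

theorem coeFn_radialMap (g : Lp ℂ 2 normSqMeasure) :
    radialMap g =ᵐ[volume] fun x => g (‖x‖ ^ 2) :=
  Lp.coeFn_compMeasurePreserving g measurePreserving_norm_sq

/-- The space of the radial functions in `L²(ℝ²)`. -/
def radialSubmodule : Submodule ℂ L2Plane := LinearMap.range radialMap.toLinearMap

theorem memLp_restrict_Ioi (g : Lp ℂ 2 normSqMeasure) :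
    MemLp g 2 (volume.restrict (Ioi (0 : ℝ))) := by
  have h0 : ENNReal.ofReal Real.pi ≠ 0 := by simpa using Real.pi_pos
  have hμ : volume.restrict (Ioi (0 : ℝ)) = (ENNReal.ofReal Real.pi)⁻¹ • normSqMeasure := by
    rw [normSqMeasure, smul_smul, ENNReal.inv_mul_cancel h0 ENNReal.ofReal_ne_top, one_smul]
  rw [hμ]
  exact (Lp.memLp g).smul_measure (ENNReal.inv_ne_top.2 h0)

theorem mem_radialSubmodule_of_ae_eq {f : L2Plane} {g : ℝ → ℂ} (hg : MemLp g 2 normSqMeasure)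
    (h : ∀ᵐ x : Plane, f x = g (‖x‖ ^ 2)) : f ∈ radialSubmodule := by
  refine ⟨hg.toLp g, Lp.ext ?_⟩
  have h1 := measurePreserving_norm_sq.quasiMeasurePreserving.ae_eq_comp hg.coeFn_toLp
  filter_upwards [coeFn_radialMap (hg.toLp g), h, h1] with x hx1 hx2 hx3
  exact hx1.trans (hx3.trans hx2.symm)

/-- `normSqMeasure` is a positive finite multiple of Lebesgue measure on `(0, ∞)`, so both have the
same null sets and the same square-integrable functions. -/
theorem radialL2_eq : radialL2 = (radialSubmodule : Set L2Plane) := by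
  ext f
  constructor
  · rintro ⟨g, hg⟩
    exact mem_radialSubmodule_of_ae_eq ((Lp.memLp g).smul_measure ENNReal.ofReal_ne_top) hg
  · rintro ⟨g, rfl⟩
    have hg := memLp_restrict_Ioi g
    refine ⟨hg.toLp g, ?_⟩
    have h0 : hg.toLp g =ᵐ[normSqMeasure] g := Measure.ae_smul_measure hg.coeFn_toLp _
    have h1 := measurePreserving_norm_sq.quasiMeasurePreserving.ae_eq_comp h0
    filter_upwards [coeFn_radialMap g, h1] with x hx1 hx2
    exact hx1.trans hx2.symm

theorem isClosed_radialSubmodule : IsClosed (radialSubmodule : Set L2Plane) := by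
  have := radialMap.isometry.isClosedEmbedding.isClosed_range
  exact this

theorem heatKernel_mem_radialSubmodule (t : ℝ) : heatKernel t ∈ radialSubmodule := by
  by_cases ht : 0 < t
  · set g : ℝ → ℂ := fun r => (((4 * Real.pi * t)⁻¹ * Real.exp (-(4 * t)⁻¹ * r) : ℝ) : ℂ) with hg
    have hgc : Continuous g := by fun_prop
    have hgm : MemLp g 2 normSqMeasure := by
      rw [← measurePreserving_norm_sq.map_eq,
        memLp_map_measure_iff hgc.aestronglyMeasurable (by fun_prop)]
      exact memLp_heatKernelFun ht
    exact mem_radialSubmodule_of_ae_eq hgm (coeFn_heatKernel ht)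
  · rw [heatKernel, dif_neg ht]
    exact zero_mem _

/-- The reflection `(x₁, x₂) ↦ (-x₁, x₂)`. -/
def reflection : Plane ≃ₗᵢ[ℝ] Plane :=
  LinearIsometryEquiv.piLpCongrRight 2 fun i : Fin 2 =>
    if i = 0 then LinearIsometryEquiv.neg ℝ else LinearIsometryEquiv.refl ℝ ℝ

theorem reflection_apply (x : Plane) : reflection x = !₂[-x 0, x 1] := by
  ext i
  fin_cases i <;> simp [reflection]

/-- The reflection preserves both the norm and Lebesgue measure. -/
theorem radialSubmodule_subset_evenL2 : (radialSubmodule : Set L2Plane) ⊆ evenL2 := by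
  rintro f ⟨g, rfl⟩ φ ψ h
  change (radialMap g : 𝓢'(Plane, ℂ)) φ = (radialMap g : 𝓢'(Plane, ℂ)) ψ
  have hint : ∀ χ : 𝓢(Plane, ℂ), (radialMap g : 𝓢'(Plane, ℂ)) χ = ∫ x, χ x • g (‖x‖ ^ 2) := by
    intro χ
    rw [Lp.toTemperedDistribution_apply]
    refine integral_congr_ae ?_
    filter_upwards [coeFn_radialMap g] with x hx
    rw [hx]
  rw [hint, hint,
    ← reflection.measurePreserving.integral_comp reflection.toHomeomorph.measurableEmbedding]
  congr 1
  ext x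
  rw [h x, LinearIsometryEquiv.norm_map, reflection_apply]

/-! ### The Laplace transform and orthogonality to heat kernels. -/

/-- Injectivity of the Laplace transform, from its values along an arithmetic progression. -/
theorem ae_eq_zero_of_laplace_eq_zero {g : ℝ → ℂ} {c : ℝ} (hc : 0 < c)
    (hg : MemLp g 2 (volume.restrict (Ioi (0 : ℝ))))
    (h : ∀ n : ℕ, ∫ r in Ioi (0 : ℝ), (Real.exp (-(c + n) * r) : ℂ) * g r = 0) :
    g =ᵐ[volume.restrict (Ioi (0 : ℝ))] 0 := by
  -- The weight `e^{-cr}` makes `k` integrable by Cauchy–Schwarz, and the hypotheses become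
  -- vanishing moments of `k` against the powers of `y = e^{-r} ∈ (0, 1)`. Weierstrass approximation
  -- extends this to all continuous functions of `y`.
  set k : ℝ → ℂ := fun r => (Real.exp (-c * r) : ℂ) * g r with hk
  have hexp : MemLp (fun r => (Real.exp (-c * r) : ℂ)) 2 (volume.restrict (Ioi (0 : ℝ))) := by
    rw [memLp_two_iff_integrable_sq_norm
      (by fun_prop : Continuous fun r : ℝ => (Real.exp (-c * r) : ℂ)).aestronglyMeasurable]
    refine (integrableOn_exp_mul_Ioi (a := -(2 * c)) (by linarith) 0).congr (.of_forall fun r => ?_)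
    simp only [Complex.norm_real, Real.norm_of_nonneg (Real.exp_nonneg _), ← Real.exp_nat_mul]
    congr 1
    push_cast
    ring
  have hkint : IntegrableOn k (Ioi 0) := hexp.integrable_mul hg
  have hpow : ∀ n : ℕ, ∫ r in Ioi (0 : ℝ), ((Real.exp (-r) ^ n : ℝ) : ℂ) * k r = 0 := by
    intro n
    rw [← h n]
    congr 1
    ext r
    rw [hk, ← mul_assoc, ← Complex.ofReal_mul, ← Real.exp_nat_mul, ← Real.exp_add]
    congr 4
    ring
  have hbdd : ∀ ψ : ℝ → ℝ, Continuous ψ →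
      IntegrableOn (fun r => ((ψ (Real.exp (-r)) : ℝ) : ℂ) * k r) (Ioi 0) := by
    intro ψ hψ
    obtain ⟨C, hC⟩ := (isCompact_Icc (a := (0 : ℝ)) (b := 1)).exists_bound_of_continuousOn
      hψ.continuousOn
    refine Integrable.bdd_mul (c := C) hkint
      (by fun_prop : Continuous fun r : ℝ => ((ψ (Real.exp (-r)) : ℝ) : ℂ)).aestronglyMeasurable ?_
    filter_upwards [ae_restrict_mem measurableSet_Ioi] with r hr
    rw [Complex.norm_real]
    exact hC _ ⟨(Real.exp_pos _).le, Real.exp_le_one_iff.2 (by simpa using (mem_Ioi.1 hr).le)⟩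
  have hpoly : ∀ p : Polynomial ℝ,
      ∫ r in Ioi (0 : ℝ), ((p.eval (Real.exp (-r)) : ℝ) : ℂ) * k r = 0 := by
    intro p
    induction p using Polynomial.induction_on' with
    | add p q hp hq =>
      simp only [Polynomial.eval_add, Complex.ofReal_add, add_mul]
      rw [integral_add (hbdd _ p.continuous) (hbdd _ q.continuous), hp, hq, add_zero]
    | monomial n a =>
      simp only [Polynomial.eval_monomial, Complex.ofReal_mul, mul_assoc]
      rw [integral_const_mul, hpow n, mul_zero]
  have hcont : ∀ ψ : ℝ → ℝ, Continuous ψ →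
      ∫ r in Ioi (0 : ℝ), ((ψ (Real.exp (-r)) : ℝ) : ℂ) * k r = 0 := by
    intro ψ hψ
    rw [← norm_le_zero_iff]
    refine le_of_forall_pos_le_add fun ε hε => ?_
    set I := ∫ r in Ioi (0 : ℝ), ‖k r‖ with hI
    have hI0 : 0 ≤ I := integral_nonneg fun _ => norm_nonneg _
    -- The denominator `I + 1` stays positive even if `I = 0`.
    obtain ⟨p, hp⟩ := exists_polynomial_near_of_continuousOn 0 1 ψ hψ.continuousOn
      (ε / (I + 1)) (by positivity)
    have heq : ∫ r in Ioi (0 : ℝ), ((ψ (Real.exp (-r)) : ℝ) : ℂ) * k r =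
        ∫ r in Ioi (0 : ℝ), ((ψ (Real.exp (-r)) - p.eval (Real.exp (-r)) : ℝ) : ℂ) * k r := by
      simp only [Complex.ofReal_sub, sub_mul]
      rw [integral_sub (hbdd ψ hψ) (hbdd _ p.continuous), hpoly, sub_zero]
    rw [heq, zero_add]
    calc _ ≤ ∫ r in Ioi (0 : ℝ), ε / (I + 1) * ‖k r‖ := by
          refine norm_integral_le_of_norm_le (hkint.norm.const_mul _) ?_
          filter_upwards [ae_restrict_mem measurableSet_Ioi] with r hr
          rw [norm_mul, Complex.norm_real, norm_sub_rev]
          gcongr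
          exact (hp _ ⟨(Real.exp_pos _).le,
            Real.exp_le_one_iff.2 (by simpa using (mem_Ioi.1 hr).le)⟩).le
      _ = ε / (I + 1) * I := integral_const_mul _ _
      _ ≤ ε := by
          rw [div_mul_eq_mul_div, div_le_iff₀ (by positivity)]
          nlinarith
  have hzero : ∀ᵐ r : ℝ, (Ioi (0 : ℝ)).indicator k r = 0 := by
    refine ae_eq_zero_of_integral_contDiff_smul_eq_zero
      (hkint.integrable_indicator measurableSet_Ioi).locallyIntegrable fun φ hφ hφc => ?_
    obtain ⟨M, hM⟩ := hφc.isCompact.isBounded.exists_norm_le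
    have hφ0 : ∀ r, M < r → φ r = 0 := fun r hr => by
      by_contra hne
      exact absurd (hM r (subset_tsupport _ hne)) (by
        rw [not_le, Real.norm_eq_abs]; exact hr.trans_le (le_abs_self r))
    -- This is the test function `φ` in the variable `y = e^{-r}`. It is continuous at `0` because
    -- `φ` vanishes beyond `M`, hence `ψ` vanishes for `y < e^{-M}`.
    set ψ : ℝ → ℝ := fun y => if 0 < y then φ (-Real.log y) else 0 with hψ
    have hψc : Continuous ψ := by
      rw [continuous_iff_continuousAt]
      intro y
      rcases lt_or_ge 0 y with hy | hy
      · have hev : ψ =ᶠ[𝓝 y] fun y => φ (-Real.log y) := by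
          filter_upwards [Ioi_mem_nhds hy] with z hz
          simp only [hψ, if_pos (mem_Ioi.1 hz)]
        refine ContinuousAt.congr ?_ hev.symm
        exact hφ.continuous.continuousAt.comp (Real.continuousAt_log hy.ne').neg
      · have hev : ψ =ᶠ[𝓝 y] fun _ => 0 := by
          filter_upwards [Iio_mem_nhds (hy.trans_lt (Real.exp_pos (-M)))] with z hz
          by_cases hz0 : 0 < z
          · simp only [hψ, if_pos hz0]
            refine hφ0 _ ?_
            have := (Real.log_lt_iff_lt_exp hz0).2 hz
            linarith
          · simp only [hψ, if_neg hz0]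
        exact continuousAt_const.congr hev.symm
    rw [← hcont ψ hψc, ← integral_indicator measurableSet_Ioi]
    congr 1
    ext r
    by_cases hr : r ∈ Ioi (0 : ℝ)
    · simp [indicator_of_mem hr, hψ, Real.exp_pos]
    · simp [indicator_of_notMem hr]
  rw [EventuallyEq, ae_restrict_iff' measurableSet_Ioi]
  filter_upwards [hzero] with r hr hr0
  rw [indicator_of_mem hr0, hk] at hr
  simpa using hr

/-- A radial function that is orthogonal to the heat kernels at the times in `(0, T)` vanishes. -/
theorem eq_zero_of_inner_heatKernel {T : ℝ} (hT : 0 < T) {f : L2Plane} (hf : f ∈ radialSubmodule)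
    (h : ∀ t ∈ Ioo 0 T, inner ℂ (heatKernel t) f = 0) : f = 0 := by
  obtain ⟨g, rfl⟩ := hf
  have hg := memLp_restrict_Ioi g
  have hpi := Real.pi_pos
  have hlap : ∀ t ∈ Ioo 0 T, ∫ r in Ioi (0 : ℝ), (Real.exp (-(4 * t)⁻¹ * r) : ℂ) * g r = 0 := by
    intro t ht
    have h1 : inner ℂ (heatKernel t) (radialMap g) = 0 := h t ht
    have h2 : inner ℂ (heatKernel t) (radialMap g) = ∫ x : Plane, (fun r : ℝ =>
        (((4 * Real.pi * t)⁻¹ : ℝ) : ℂ) * ((Real.exp (-(4 * t)⁻¹ * r) : ℂ) * g r)) (‖x‖ ^ 2) := by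
      rw [L2.inner_def]
      refine integral_congr_ae ?_
      filter_upwards [coeFn_heatKernel ht.1, coeFn_radialMap g] with x hx1 hx2
      change inner ℂ (heatKernel t x) (radialMap g x) = _
      rw [hx1, hx2, RCLike.inner_apply, heatKernelFun]
      simp only [Complex.conj_ofReal]
      push_cast
      ring
    have hmeas : AEStronglyMeasurable (fun r : ℝ =>
        (((4 * Real.pi * t)⁻¹ : ℝ) : ℂ) * ((Real.exp (-(4 * t)⁻¹ * r) : ℂ) * g r))
        (Measure.map (fun x : Plane => ‖x‖ ^ 2) volume) := by
      rw [measurePreserving_norm_sq.map_eq]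
      exact ((by fun_prop : Continuous fun r : ℝ =>
        (Real.exp (-(4 * t)⁻¹ * r) : ℂ)).aestronglyMeasurable.mul (Lp.aestronglyMeasurable g)).const_mul _
    rw [h2, ← integral_map (by fun_prop) hmeas, measurePreserving_norm_sq.map_eq,
      integral_normSqMeasure, integral_const_mul, smul_eq_zero,
      mul_eq_zero] at h1
    have h3 : (((4 * Real.pi * t)⁻¹ : ℝ) : ℂ) ≠ 0 := by
      have : (4 * Real.pi * t)⁻¹ ≠ 0 := by have := ht.1; positivity
      exact_mod_cast this
    rcases h1 with h1 | h1 | h1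
    · exact absurd h1 hpi.ne'
    · exact absurd h1 h3
    · exact h1
  -- The points `c + n` with `c = 1/(4T) + 1` all exceed `1/(4T)`, so each is `1/(4t)` for some `t ∈
  -- (0, T)`.
  have h0 := ae_eq_zero_of_laplace_eq_zero (c := (4 * T)⁻¹ + 1) (by positivity) hg fun n => by
    have hpos : 0 < (4 * T)⁻¹ + 1 + (n : ℝ) := by positivity
    have := hlap (4 * ((4 * T)⁻¹ + 1 + (n : ℝ)))⁻¹ ⟨by positivity, by
      rw [inv_lt_comm₀ (by positivity) hT]
      have : 4 * (4 * T)⁻¹ = T⁻¹ := by field_simp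
      have hn : (0 : ℝ) ≤ n := n.cast_nonneg
      linarith⟩
    have he : (4 * (4 * ((4 * T)⁻¹ + 1 + (n : ℝ)))⁻¹)⁻¹ = (4 * T)⁻¹ + 1 + (n : ℝ) := by
      field_simp
    rwa [he] at this
  have hg0 : g = 0 := by
    apply Lp.ext
    have h1 : g =ᵐ[normSqMeasure] 0 := Measure.ae_smul_measure h0 _
    exact h1.trans (Lp.coeFn_zero ℂ 2 normSqMeasure).symm
  rw [hg0]
  exact map_zero radialMap

/-! ### The states reachable from zero. -/

/-- The control `u` on `(0, T)`, extended by `0`. -/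
def extendedControl (T : ℝ) (u : ℝ → ℂ) : ℝ → ℂ := (Ioo 0 T).indicator u

/-- The heat kernel on `(0, T]`, extended by `0`. -/
def truncatedKernel (T : ℝ) : ℝ → L2Plane := (Ioc 0 T).indicator heatKernel

/-- The state at time `t` steered from `0` by the control `u` on `(0, T)`. -/
def controlledState (T : ℝ) (u : ℝ → ℂ) (t : ℝ) : L2Plane :=
  (-2 : ℂ) • ∫ s, extendedControl T u s • truncatedKernel T (t - s)

section

variable {T : ℝ} {u : ℝ → ℂ}

theorem memLp_extendedControl (hu : MemLp u ∞ (volume.restrict (Ioo 0 T))) :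
    MemLp (extendedControl T u) ∞ volume :=
  (memLp_indicator_iff_restrict measurableSet_Ioo).2 hu

theorem integrable_extendedControl (hu : MemLp u ∞ (volume.restrict (Ioo 0 T))) :
    Integrable (extendedControl T u) :=
  (integrable_indicator_iff measurableSet_Ioo).2 (hu.integrable le_top)

theorem integrable_truncatedKernel (T : ℝ) : Integrable (truncatedKernel T) :=
  (integrable_indicator_iff measurableSet_Ioc).2 (integrableOn_heatKernel T)

theorem integrable_control_smul_kernel (hu : MemLp u ∞ (volume.restrict (Ioo 0 T))) (t : ℝ) :
    Integrable fun s => extendedControl T u s • truncatedKernel T (t - s) := by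
  rw [← memLp_one_iff_integrable]
  exact (memLp_one_iff_integrable.2 ((integrable_truncatedKernel T).comp_sub_left t)).smul
    (memLp_extendedControl hu)

theorem truncatedKernel_mem_radialSubmodule (T t : ℝ) : truncatedKernel T t ∈ radialSubmodule := by
  by_cases ht : t ∈ Ioc 0 T
  · rw [truncatedKernel, indicator_of_mem ht]
    exact heatKernel_mem_radialSubmodule t
  · rw [truncatedKernel, indicator_of_notMem ht]
    exact zero_mem _

theorem controlledState_mem_radialSubmodule (hu : MemLp u ∞ (volume.restrict (Ioo 0 T))) (t : ℝ) :
    controlledState T u t ∈ radialSubmodule := by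
  have : CompleteSpace radialSubmodule := isClosed_radialSubmodule.completeSpace_coe
  refine Submodule.smul_mem _ _ ?_
  -- Membership in the closed subspace means being fixed by the orthogonal projection, which
  -- commutes with the integral.
  rw [← Submodule.starProjection_eq_self_iff,
    ← ContinuousLinearMap.integral_comp_comm _ (integrable_control_smul_kernel hu t)]
  congr 1
  ext1 s
  rw [Submodule.starProjection_eq_self_iff]
  exact Submodule.smul_mem _ _ (truncatedKernel_mem_radialSubmodule T _)

theorem controlledState_zero : controlledState T u 0 = 0 := by
  have : ∀ s, extendedControl T u s • truncatedKernel T (0 - s) = 0 := by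
    intro s
    by_cases hs : s ∈ Ioo 0 T
    · rw [truncatedKernel, indicator_of_notMem (fun h => by linarith [h.1, hs.1]), smul_zero]
    · rw [extendedControl, indicator_of_notMem hs, zero_smul]
  rw [controlledState, integral_congr_ae (.of_forall this)]
  simp

theorem controlledState_add {v : ℝ → ℂ} (hu : MemLp u ∞ (volume.restrict (Ioo 0 T)))
    (hv : MemLp v ∞ (volume.restrict (Ioo 0 T))) (t : ℝ) :
    controlledState T (u + v) t = controlledState T u t + controlledState T v t := by
  rw [controlledState, controlledState, controlledState, ← smul_add,
    ← integral_add (integrable_control_smul_kernel hu t) (integrable_control_smul_kernel hv t)]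
  simp only [extendedControl, indicator_add', Pi.add_apply, add_smul]

theorem controlledState_smul (c : ℂ) (u : ℝ → ℂ) (t : ℝ) :
    controlledState T (c • u) t = c • controlledState T u t := by
  rw [controlledState, controlledState, smul_comm c, ← integral_smul c]
  simp only [extendedControl, indicator_const_smul, Pi.smul_def, smul_assoc]

theorem isSolution_controlledState (hu : MemLp u ∞ (volume.restrict (Ioo 0 T))) :
    IsSolution T u 0 (controlledState T u) := by
  have hL : Integrable fun t => laplaceOp (controlledState T u t) :=
    laplaceOp.integrable_comp ((integrable_integral_smul_comp_sub (integrable_extendedControl hu)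
      (integrable_truncatedKernel T)).smul (-2 : ℂ))
  have hR : Integrable fun t => (2 * extendedControl T u t) • besselDelta :=
    ((integrable_extendedControl hu).const_mul 2).smul_const besselDelta
  refine isSolution_iff.2 ⟨fun t _ => radialSubmodule_subset_evenL2
    (controlledState_mem_radialSubmodule hu t), controlledState_zero,
    fun t => laplaceOp (controlledState T u t) - (2 * extendedControl T u t) • besselDelta,
    ?_, ?_, ?_⟩
  · exact (hL.sub hR).intervalIntegrable
  · filter_upwards [ae_restrict_mem measurableSet_Ioo] with t ht
    rw [extendedControl, indicator_of_mem ht]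
  · intro t ht
    have hD : besselOp (∫ s, extendedControl T u s • truncatedKernel T (t - s)) =
        (∫ τ in (0 : ℝ)..t, laplaceOp (∫ s, extendedControl T u s • truncatedKernel T (τ - s))) +
          (∫ s in (0 : ℝ)..t, extendedControl T u s) • besselDelta := duhamel_formula besselOp laplaceOp besselDelta (T := T)
      (integrable_extendedControl hu) (integrable_truncatedKernel T)
      (fun s hs => indicator_of_notMem (fun h => h.1.not_ge hs) _)
      (fun s hs => indicator_of_notMem (fun h => h.1.not_ge hs) _)
      (integrable_control_smul_kernel hu) (fun r hr => by
        rw [truncatedKernel, indicator_of_mem hr, besselOp_heatKernel hr.1]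
        congr 1
        refine intervalIntegral.integral_congr_ae (.of_forall fun σ hσ => ?_)
        rw [uIoc_of_le hr.1.le] at hσ
        rw [indicator_of_mem (show σ ∈ Ioc 0 T from ⟨hσ.1, hσ.2.trans hr.2⟩)]) ht
    rw [controlledState_zero, map_zero, zero_add, intervalIntegral.integral_sub
      hL.intervalIntegrable hR.intervalIntegrable,
      intervalIntegral.integral_smul_const, intervalIntegral.integral_const_mul]
    simp only [controlledState, map_smul]
    rw [intervalIntegral.integral_smul, hD, smul_add, smul_smul, neg_mul, neg_smul, neg_smul,
      sub_eq_add_neg]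

/-- Uniqueness forces every solution from zero to be Duhamel's integral, so the reachable set is the
image of a linear map of `u`. -/
theorem mem_reachableSet_zero_iff (hT : 0 < T) {f : L2Plane} : f ∈ reachableSet T 0 ↔
    ∃ u : ℝ → ℂ, MemLp u ∞ (volume.restrict (Ioo 0 T)) ∧ controlledState T u T = f := by
  constructor
  · rintro ⟨-, u, hu, W, -, hW, rfl⟩
    exact ⟨u, hu, hW _ (isSolution_controlledState hu) ⟨hT.le, le_rfl⟩⟩
  · rintro ⟨u, hu, rfl⟩
    exact ⟨radialSubmodule_subset_evenL2 (controlledState_mem_radialSubmodule hu T), u, hu, _,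
      isSolution_controlledState hu, fun V hV => hV.eqOn hT (isSolution_controlledState hu),
      rfl⟩

end

/-! ### Density in the radial functions. -/

/-- The reachable set from `0` as a subspace. -/
def reachableSubmodule (T : ℝ) : Submodule ℂ L2Plane where
  carrier := {f | ∃ u : ℝ → ℂ, MemLp u ∞ (volume.restrict (Ioo 0 T)) ∧ controlledState T u T = f}
  add_mem' := by
    rintro _ _ ⟨u, hu, rfl⟩ ⟨v, hv, rfl⟩
    exact ⟨u + v, hu.add hv, controlledState_add hu hv T⟩
  zero_mem' := ⟨0, MemLp.zero, by simpa using controlledState_smul (T := T) 0 0 T⟩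
  smul_mem' := by
    rintro c _ ⟨u, hu, rfl⟩
    exact ⟨c • u, hu.const_smul c, controlledState_smul c u T⟩

/-- Controls that are indicators of measurable sets show that `s ↦ ⟨f, K(T - s)⟩` has zero integral
over every measurable subset of `(0, T)`, hence vanishes almost everywhere. Continuity of `K` in
time removes the exceptional set. -/
theorem inner_heatKernel_eq_zero {T : ℝ} {f : L2Plane}
    (hf : ∀ u : ℝ → ℂ, MemLp u ∞ (volume.restrict (Ioo 0 T)) →
      inner ℂ f (controlledState T u T) = 0) :
    ∀ t ∈ Ioo 0 T, inner ℂ (heatKernel t) f = 0 := by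
  set q : ℝ → ℂ := fun s => inner ℂ f (truncatedKernel T (T - s)) with hq
  have hqint : Integrable q :=
    ((innerSL ℂ f).integrable_comp ((integrable_truncatedKernel T).comp_sub_left T))
  have hset : ∀ A, MeasurableSet A → ∫ s in A, q s ∂(volume.restrict (Ioo 0 T)) = 0 := by
    intro A hA
    have hu : MemLp (A.indicator fun _ => (1 : ℂ)) ∞ (volume.restrict (Ioo 0 T)) :=
      (memLp_const 1).indicator hA
    have h := hf _ hu
    rw [controlledState, inner_smul_right, mul_eq_zero] at h
    have h := h.resolve_left (by norm_num)
    have hc := (innerSL ℂ f).integral_comp_comm (integrable_control_smul_kernel hu T)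
    simp only [innerSL_apply_apply] at hc
    rw [← hc] at h
    rw [← integral_indicator hA, ← integral_indicator measurableSet_Ioo, ← h]
    congr 1
    ext s
    by_cases hs : s ∈ Ioo 0 T <;> by_cases hsA : s ∈ A <;>
      simp [extendedControl, hs, hsA, hq]
  have hae : q =ᵐ[volume.restrict (Ioo 0 T)] 0 :=
    hqint.restrict.ae_eq_zero_of_forall_setIntegral_eq_zero fun A hA _ => hset A hA
  have hcont : ContinuousOn q (Ioo 0 T) := by
    have h1 : ContinuousOn (fun s => inner ℂ f (heatKernel (T - s))) (Ioo 0 T) :=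
      (innerSL ℂ f).continuous.comp_continuousOn
        (continuousOn_heatKernel.comp (by fun_prop) fun s hs => sub_pos.2 hs.2)
    refine h1.congr fun s hs => ?_
    simp only [hq]
    rw [truncatedKernel, indicator_of_mem
      (show T - s ∈ Ioc 0 T from ⟨sub_pos.2 hs.2, by linarith [hs.1]⟩)]
  have h0 := Measure.eqOn_Ioo_of_ae_eq volume hae hcont continuousOn_const
  intro t ht
  have h := h0 (show T - t ∈ Ioo 0 T from ⟨by linarith [ht.2], by linarith [ht.1]⟩)
  simp only [hq, sub_sub_cancel, Pi.zero_apply] at h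
  rw [truncatedKernel, indicator_of_mem (show t ∈ Ioc 0 T from ⟨ht.1, ht.2.le⟩)] at h
  exact inner_eq_zero_symm.1 h

/-- The closure consists of radial functions, so the component of a radial `f` orthogonal to it is
again radial. Being orthogonal to the heat kernels at all times in `(0, T)`, that component is zero.
-/
theorem radialSubmodule_le_closure {T : ℝ} (hT : 0 < T) :
    radialSubmodule ≤ (reachableSubmodule T).topologicalClosure := by
  have hle : (reachableSubmodule T).topologicalClosure ≤ radialSubmodule :=
    Submodule.topologicalClosure_minimal _ (by
      rintro _ ⟨u, hu, rfl⟩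
      exact controlledState_mem_radialSubmodule hu T) isClosed_radialSubmodule
  intro f hf
  set K := (reachableSubmodule T).topologicalClosure with hK
  have : CompleteSpace K := (Submodule.isClosed_topologicalClosure _).completeSpace_coe
  have hmem : f - K.starProjection f ∈ radialSubmodule :=
    Submodule.sub_mem _ hf (hle (Submodule.starProjection_apply_mem K f))
  have horth : f - K.starProjection f ∈ Kᗮ := Submodule.sub_starProjection_mem_orthogonal f
  have h0 := eq_zero_of_inner_heatKernel hT hmem (inner_heatKernel_eq_zero fun u hu =>
    (Submodule.mem_orthogonal' _ _).1 horth _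
      ((reachableSubmodule T).le_topologicalClosure ⟨u, hu, rfl⟩))
  rw [sub_eq_zero] at h0
  rw [h0]
  exact Submodule.starProjection_apply_mem K f

end HeatPointControl

end

/-- For every `T > 0`, the closure in `L²(ℝ²)` of the set of the states reachable from `0` in time
`T` is the space of the radial functions in `L²(ℝ²)`. -/
theorem theorem3p12 (T : ℝ) (hT : 0 < T) :
    closure (HeatPointControl.reachableSet T 0) = HeatPointControl.radialL2 := by
  have h : HeatPointControl.reachableSet T 0 = HeatPointControl.reachableSubmodule T :=
    Set.ext fun _ => HeatPointControl.mem_reachableSet_zero_iff hT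
  rw [h, HeatPointControl.radialL2_eq, ← Submodule.topologicalClosure_coe]
  refine congrArg _ (le_antisymm ?_ (HeatPointControl.radialSubmodule_le_closure hT))
  refine Submodule.topologicalClosure_minimal _ ?_ HeatPointControl.isClosed_radialSubmodule
  rintro _ ⟨u, hu, rfl⟩
  exact HeatPointControl.controlledState_mem_radialSubmodule hu T
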